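/- Let $m \ge 5$, let $n = 2^m-1$, and let $\alpha$ be a generator of the multiplicative group $\mathrm{GF}(2^m)^*$. For $i \ge 1$ let $m_i(x)$ be the minimal polynomial of $\alpha^i$ over $\mathrm{GF}(2)$. Put $$\delta_3 = 2^{m-1}-1-2^{\lfloor (m+1)/2\rfloor}, \qquad g(x) = \mathrm{lcm}\bigl(m_1(x), m_2(x), \dots, m_{\delta_3-1}(x)\bigr),$$ and let $\mathcal{C}_{(2,m,\delta_3)} \subseteq \mathrm{GF}(2)^n$ be the cyclic code of length $n$ with generator polynomial $g(x)$, that is, the set of all $(c_0,\dots,c_{n-1})$ for which $c_0 + c_1x+\dots+c_{n-1}x^{n-1}$ lies in the ideal generated by $g(x)$ in $\mathrm{GF}(2)[x]/(x^n-1)$ (the narrow-sense primitive binary BCH code with design distance $\delta_3$). Let $$\mathcal{C}_{(2,m,\delta_3)}^\perp = \Bigl\{v \in \mathrm{GF}(2)^n : \sum_{i=0}^{n-1} v_i c_i = 0 \text{ for all } c \in \mathcal{C}_{(2,m,\delta_3)}\Bigr\}$$ be its dual code. Then the minimum Hamming distance $d^\perp$ of $\mathcal{C}_{(2,m,\delta_3)}^\perp$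 is equal to $8$ if $m \ge 5$ is odd, and is equal to $6$ if $m \ge 6$ is even. -/

import Mathlib

open Polynomial

/-- The `F`-linear map sending a vector `(c₀, …, c_{n-1})` to the class of
`c₀ + c₁ x + ⋯ + c_{n-1} x ^ (n-1)` in `F[x] / (x ^ n - 1)`. -/
noncomputable def wordToQuotient (F : Type*) [Field F] (n : ℕ) :
    (Fin n → F) →ₗ[F] (F[X] ⧸ Ideal.span {(X ^ n - 1 : F[X])}) :=
  (Ideal.Quotient.mkₐ F (Ideal.span {(X ^ n - 1 : F[X])})).toLinearMap ∘ₗ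
    ∑ i : Fin n, Polynomial.monomial (i : ℕ) ∘ₗ LinearMap.proj i

/-- The cyclic code of length `n` over `F` generated by `g`: the vectors whose polynomial lies in
the ideal of `F[x] / (x ^ n - 1)` generated by the class of `g`. -/
noncomputable def cyclicCode {F : Type*} [Field F] (n : ℕ) (g : F[X]) : Submodule F (Fin n → F) :=
  ((Ideal.span {Ideal.Quotient.mk (Ideal.span {(X ^ n - 1 : F[X])}) g}).restrictScalars F).comap
    (wordToQuotient F n)

/-- `g(x) = lcm (m₁(x), …, m_{δ-1}(x))`, the monic least common multiple, where `mᵢ` is the minimal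
polynomial of `α ^ i` over `F`. -/
noncomputable def bchGenerator (F : Type*) {K : Type*} [Field F] [Field K] [Algebra F K]
    (α : K) (δ : ℕ) : F[X] :=
  letI : DecidableEq F := Classical.decEq F
  letI : NormalizedGCDMonoid F[X] := UniqueFactorizationMonoid.toNormalizedGCDMonoid F[X]
  (Finset.Icc 1 (δ - 1)).lcm fun i => minpoly F (α ^ i)

/-- The narrow-sense BCH code of length `n` with design distance `δ` with respect to `α`. It is
the narrow-sense primitive BCH code when `α` generates `GF(q ^ m)ˣ` and `n = q ^ m - 1`. -/
noncomputable def bchCode (F : Type*) {K : Type*} [Field F] [Field K] [Algebra F K]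
    (n : ℕ) (α : K) (δ : ℕ) : Submodule F (Fin n → F) :=
  cyclicCode n (bchGenerator F α δ)

/-- The design distance `(q - 1) q ^ (m - 1) - 1 - q ^ ⌊(m + 1) / 2⌋`
(no subtraction truncates when `q ≥ 2` and `m ≥ 4`). -/
def delta3 (q m : ℕ) : ℕ := (q - 1) * q ^ (m - 1) - 1 - q ^ ((m + 1) / 2)

/-- The dual code, with respect to the standard bilinear form. -/
def dualCode {F : Type*} [Field F] {n : ℕ} (C : Submodule F (Fin n → F)) :
    Submodule F (Fin n → F) where
  carrier := {v | ∀ c ∈ C, ∑ i, v i * c i = 0}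
  zero_mem' := fun c _ => by simp
  add_mem' := fun {u v} hu hv c hc => by
    simp only [Pi.add_apply, add_mul, Finset.sum_add_distrib, hu c hc, hv c hc, add_zero]
  smul_mem' := fun a v hv c hc => by
    simp only [Pi.smul_apply, smul_eq_mul, mul_assoc, ← Finset.mul_sum, hv c hc, mul_zero]

/-- `d` is the minimum Hamming distance of `C`: it is attained by two distinct codewords, and any
two distinct codewords are at distance at least `d`. -/
def HasMinimumDistance {F : Type*} [Field F] [DecidableEq F] {n : ℕ}
    (C : Submodule F (Fin n → F)) (d : ℕ) : Prop :=
  IsLeast {k : ℕ | ∃ u ∈ C, ∃ v ∈ C, u ≠ v ∧ hammingDist u v = k} d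

theorem forall_lt_of_rotation_invariant {m h : ℕ} (hm : m = 2 * h + 1 ∧ 2 ≤ h ∨ m = 2 * h ∧ 3 ≤ h)
    (P : ℕ → Prop) (hdouble : ∀ s, P (2 * s) → P s)
    (hperiod : ∀ s, P s → P (s + (2 ^ m - 1)))
    (hlarge : ∀ s, 2 ^ (m - 1) + 2 ^ (m - h) < s → s < 2 ^ m - 1 → P s)
    (h0 : P 0) (h1 : P 1) (h2 : P (2 ^ h + 1)) (h3 : P (2 ^ (h - 1) + 1)) :
    ∀ s < 2 ^ m - 1, P s := by
  have hpow : ∀ k s, P (2 ^ k * s) → P s := by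
    intro k
    induction k with
    | zero => intro s hs; simpa using hs
    | succ k ih =>
      intro s hs
      refine ih _ (hdouble _ ?_)
      rwa [← mul_assoc, ← pow_succ']
  have hmul : ∀ x s, P s → P (s + x * (2 ^ m - 1)) := by
    intro x s hs
    induction x with
    | zero => simpa using hs
    | succ x ih =>
      have := hperiod _ ih
      rwa [add_assoc, ← Nat.succ_mul] at this
  have hrot : ∀ x y, P (x + y) → P (2 ^ m * x + y) := by
    intro x y hxy
    have := hmul x _ hxy
    have e : x + y + x * (2 ^ m - 1) = 2 ^ m * x + y := by
      obtain ⟨N, hN⟩ : ∃ N, 2 ^ m = N + 1 := ⟨2 ^ m - 1, by have := Nat.one_le_two_pow (n := m); omega⟩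
      rw [hN]; simp only [Nat.add_sub_cancel]; ring
    rwa [e] at this
  -- powers of two times a representative
  have hshift : ∀ j s, j ≤ m → P s → P (2 ^ j * s) := by
    intro j s hj hs
    refine hpow (m - j) _ ?_
    rw [← mul_assoc, ← pow_add, Nat.sub_add_cancel hj]
    simpa using hrot s 0 (by simpa using hs)
  have hdown : ∀ d s, s + d = 2 ^ m - 1 → s < 2 ^ m - 1 → P s := by
    intro d
    induction d using Nat.strong_induction_on with
    | _ d ih =>
    intro s hsd hs
    have hmm : 2 ^ m = 2 * 2 ^ (m - 1) := by
      rw [← pow_succ']; congr 1; omega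
    rcases Nat.lt_or_ge s (2 ^ (m - 1)) with hlt | hge
    · rcases Nat.eq_zero_or_pos s with rfl | hpos
      · exact h0
      · exact hdouble s (ih (d - s) (by omega) (2 * s) (by omega) (by omega))
    rcases Nat.lt_or_ge (2 ^ (m - 1) + 2 ^ (m - h)) s with hl | hle
    · exact hlarge s hl hs
    obtain ⟨r, rfl⟩ := Nat.exists_eq_add_of_le hge
    have hr : r ≤ 2 ^ (m - h) := by omega
    rcases Nat.eq_zero_or_pos r with rfl | hrpos
    · simpa using hshift (m - 1) 1 (by omega) h1
    rcases Nat.eq_or_lt_of_le hr with rfl | hrlt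
    · have := hshift (m - h) _ (by omega) h3
      rwa [mul_add, ← pow_add, mul_one, show m - h + (h - 1) = m - 1 by omega] at this
    obtain ⟨f, hf⟩ : ∃ f, f = Nat.log 2 r := ⟨_, rfl⟩
    have hf1 : 2 ^ f ≤ r := hf ▸ Nat.pow_log_le_self 2 (by omega)
    have hf2 : r < 2 ^ (f + 1) := hf ▸ Nat.lt_pow_succ_log_self (by norm_num) r
    have hfe : f < m - h := (Nat.pow_lt_pow_iff_right (by norm_num : 1 < 2)).1 (lt_of_le_of_lt hf1 hrlt)
    obtain ⟨g, hg⟩ : ∃ g, m = f + g + 2 := ⟨m - 2 - f, by omega⟩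
    obtain ⟨r', rfl⟩ := Nat.exists_eq_add_of_le hf1
    have hr' : r' + 1 ≤ 2 ^ f := by rw [pow_succ] at hf2; omega
    -- the rotation bringing the second highest bit to the top
    have hred : P (2 ^ (m - 1) + r' * 2 ^ (g + 1) + 2 ^ g) → P (2 ^ (m - 1) + (2 ^ f + r')) := by
      intro hP
      refine hpow (g + 1) _ ?_
      have := hrot (2 ^ g) (2 ^ (m - 1) + r' * 2 ^ (g + 1)) (by rwa [add_comm])
      convert this using 1
      rw [hmm, show m - 1 = f + (g + 1) by omega]; ring
    have hlt' : 2 ^ (m - 1) + r' * 2 ^ (g + 1) + 2 ^ g < 2 ^ m - 1 := by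
      have e1 : (r' + 1) * 2 ^ (g + 1) ≤ 2 ^ f * 2 ^ (g + 1) := Nat.mul_le_mul_right _ hr'
      rw [← pow_add, show f + (g + 1) = m - 1 by omega, add_mul] at e1
      have e2 := pow_succ 2 g
      have e3 : 1 ≤ 2 ^ g := Nat.one_le_two_pow
      have e4 : 2 ^ 1 ≤ 2 ^ g := Nat.pow_le_pow_right (by norm_num) (by omega)
      omega
    rcases Nat.lt_or_ge (2 ^ (m - 1) + 2 ^ (m - h)) (2 ^ (m - 1) + r' * 2 ^ (g + 1) + 2 ^ g)
      with hl | hle'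
    · exact hred (hlarge _ hl hlt')
    have hle2 : r' * 2 ^ (g + 1) + 2 ^ g ≤ 2 ^ (m - h) := by omega
    rcases Nat.eq_zero_or_pos r' with rfl | hr'pos
    · have hgle : g ≤ m - h :=
        (Nat.pow_le_pow_iff_right (by norm_num : 1 < 2)).1 (by simpa using hle2)
      rw [add_zero]
      have hcase : f = h ∧ m - 1 = h + h ∨ f = h - 1 ∧ m - 1 = h + (h - 1) ∨
          (f + 1 = h ∨ f + 1 = h - 1) := by
        omega
      rcases hcase with ⟨rfl, e⟩ | ⟨rfl, e⟩ | e
      · have := hshift f _ (by omega) h2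
        rwa [mul_add, ← pow_add, mul_one, ← e] at this
      · have := hshift (h - 1) _ (by omega) h2
        rwa [mul_add, ← pow_add, mul_one, show h - 1 + h = m - 1 by omega] at this
      · have hP : P (2 ^ (f + 1) + 1) := by rcases e with e | e <;> rwa [e]
        refine hpow (g + 1) _ ?_
        have := hrot (2 ^ g) (2 ^ (m - 1)) ?_
        · convert this using 1
          rw [hmm, show m - 1 = f + (g + 1) by omega]; ring
        · have := hshift g _ (by omega) hP
          rwa [mul_add, ← pow_add, mul_one, add_comm, show g + (f + 1) = m - 1 by omega] at this
    · have e1 : 2 ^ (g + 1) ≤ r' * 2 ^ (g + 1) := Nat.le_mul_of_pos_left _ hr'pos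
      have e2 : 2 ^ (g + 1) < 2 ^ (m - h) := by have := Nat.one_le_two_pow (n := g); omega
      have e3 := (Nat.pow_lt_pow_iff_right (by norm_num : 1 < 2)).1 e2
      obtain ⟨rfl, hm', hgh⟩ : f = h ∧ m = 2 * f + 1 ∧ g + 1 = f := by omega
      obtain rfl : r' = 1 := by
        by_contra hne
        have e4 : 2 * 2 ^ (g + 1) ≤ r' * 2 ^ (g + 1) := Nat.mul_le_mul_right _ (by omega)
        rw [← pow_succ', show g + 1 + 1 = m - f by omega] at e4
        have := Nat.one_le_two_pow (n := g)
        omega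
      refine hpow (m - 1) _ ?_
      have := hrot (2 ^ (m - 2) + 2 ^ g) (2 ^ (m - 1)) (hlarge _ ?_ ?_)
      · convert this using 1
        rw [hm', ← hgh, show 2 * (g + 1) + 1 - 1 = 2 * g + 2 by omega,
          show 2 * (g + 1) + 1 - 2 = 2 * g + 1 by omega]
        ring
      · have := Nat.pow_le_pow_right (n := 2) (by norm_num) (show m - f ≤ m - 2 by omega)
        have := Nat.one_le_two_pow (n := g)
        omega
      · have e5 : 2 ^ (g + 1) ≤ 2 ^ (m - 2) := Nat.pow_le_pow_right (by norm_num) (by omega)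
        have e6 : 2 ^ (m - 1) = 2 * 2 ^ (m - 2) := by rw [← pow_succ']; congr 1; omega
        have e7 : 2 ^ 1 ≤ 2 ^ g := Nat.pow_le_pow_right (by norm_num) (by omega)
        have e8 := pow_succ 2 g
        omega
  intro s hs
  exact hdown _ s (Nat.add_sub_cancel' hs.le) hs

section CharTwo
variable {K : Type*} [Field K] [CharP K 2]

theorem eq_zero_or_eq_one_of_sq_eq_self {K : Type*} [Field K] {x : K} (h : x ^ 2 = x) : x = 0 ∨ x = 1 := by
  have : x * (x - 1) = 0 := by linear_combination h
  rcases mul_eq_zero.1 this with h | h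
  · exact Or.inl h
  · exact Or.inr (sub_eq_zero.1 h)

/-- Let `τ` be a square root of Frobenius. The values `p τ(q) + q τ(p)` and `p τ³(q) + q τ³(p)`
determine the `GF(2)`-plane spanned by `p` and `q`. -/
theorem mem_span_of_alternating_eq (τ : K →+* K) (hτ : ∀ x, τ (τ x) = x ^ 2) {p q c d : K}
    (hp : p ≠ 0) (hq : q ≠ 0) (hpq : p ≠ q)
    (h1 : p * τ q + q * τ p = c * τ d + d * τ c)
    (h3 : p * τ q ^ 2 + q * τ p ^ 2 = c * τ d ^ 2 + d * τ c ^ 2) :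
    c = 0 ∨ c = p ∨ c = q ∨ c = p + q := by
  have two : (2 : K) = 0 := CharTwo.two_eq_zero
  have hfix : ∀ x, τ x = x → x = 0 ∨ x = 1 := fun x hx =>
    eq_zero_or_eq_one_of_sq_eq_self (by rw [← hτ, hx, hx])
  have plucker : ∀ a b : K, (a * τ b + b * τ a) ^ 3 + (a * b * (a + b)) * τ (a * b * (a + b)) +
      (a * τ b ^ 2 + b * τ a ^ 2) * τ (a * τ b + b * τ a) = 0 := by
    intro a b
    simp only [map_mul, map_add, hτ]
    linear_combination (a ^ 3 * τ b ^ 3 + 2 * a ^ 2 * b * τ a * τ b ^ 2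
      + 2 * a * b ^ 2 * τ a ^ 2 * τ b + b ^ 3 * τ a ^ 3
      + a ^ 2 * b * τ a ^ 2 * τ b + a * b ^ 2 * τ a * τ b ^ 2) * two
  have hP : τ p ≠ 0 := (map_ne_zero τ).2 hp
  have hQ : τ q ≠ 0 := (map_ne_zero τ).2 hq
  have hpq' : p + q ≠ 0 := fun h => hpq (CharTwo.add_eq_zero.1 h)
  have hA : p * τ q + q * τ p ≠ 0 := by
    intro hA
    rcases hfix (q / p) (by
      rw [map_div₀, div_eq_div_iff hP hp]
      linear_combination hA - q * τ p * two) with h | h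
    · exact (div_ne_zero hq hp) h
    · exact hpq ((div_eq_one_iff_eq hp).1 h).symm
  have hB : p * q * (p + q) ≠ 0 := mul_ne_zero (mul_ne_zero hp hq) hpq'
  have hBB : (p * q * (p + q)) * τ (p * q * (p + q)) = (c * d * (c + d)) * τ (c * d * (c + d)) := by
    have e1 := plucker p q
    have e2 := plucker c d
    rw [h1, h3] at e1
    linear_combination e1 - e2
  have hBeq : p * q * (p + q) = c * d * (c + d) := by
    generalize p * q * (p + q) = B at hB hBB
    generalize c * d * (c + d) = B' at hBB
    have hτB : τ B ≠ 0 := (map_ne_zero τ).2 hB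
    have hB' : B' ≠ 0 := by
      rintro rfl
      rw [zero_mul] at hBB
      exact mul_ne_zero hB hτB hBB
    have ht : B / B' * τ (B / B') = 1 := by
      have : τ B' ≠ 0 := (map_ne_zero τ).2 hB'
      rw [map_div₀]; field_simp; exact hBB
    have ht0 : τ (B / B') ≠ 0 := right_ne_zero_of_mul_eq_one ht
    have ht2 := congrArg τ ht
    rw [map_mul, hτ, map_one, ← ht, mul_comm] at ht2
    rcases eq_zero_or_eq_one_of_sq_eq_self (mul_right_cancel₀ ht0 ht2) with h | h
    · exact absurd h (div_ne_zero hB hB')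
    · exact (div_eq_one_iff_eq hB').1 h
  have hrec : ∀ a b : K, a * τ (a * τ b + b * τ a) + τ a * (a * b * (a + b)) +
      a ^ 2 * (a * τ b + b * τ a) = 0 := by
    intro a b
    simp only [map_mul, map_add, hτ]
    linear_combination (a * b ^ 2 * τ a + a ^ 2 * b * τ a + a ^ 3 * τ b) * two
  have hc := hrec c d
  have hpp := hrec p q
  have hqq := hrec q p
  rw [← h1, ← hBeq] at hc
  rw [add_comm (q * τ p), add_comm q p, mul_comm q p] at hqq
  generalize hAdef : p * τ q + q * τ p = A at *
  generalize p * q * (p + q) = B at *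
  have step : ∀ z, p * z * τ A + τ (p * z) * B + (p * z) ^ 2 * A = 0 →
      (z + τ z) * (τ p * B + p ^ 2 * A) = p ^ 2 * A * τ (z + τ z) := by
    intro z hz
    rw [map_mul] at hz
    rw [map_add, hτ]
    linear_combination z * hpp + hz - (p * z * τ A + p ^ 2 * z ^ 2 * A) * two
  obtain ⟨z, rfl⟩ : ∃ z, c = p * z := ⟨c / p, (mul_div_cancel₀ c hp).symm⟩
  obtain ⟨w, rfl⟩ : ∃ w, q = p * w := ⟨q / p, (mul_div_cancel₀ q hp).symm⟩
  have hw : w + τ w ≠ 0 := by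
    intro h
    apply hA
    rw [← hAdef, map_mul]
    linear_combination p * τ p * h
  have sz := step z hc
  have sw := step w hqq
  have hD : p ^ 2 * A ≠ 0 := mul_ne_zero (pow_ne_zero 2 hp) hA
  have hratio : τ ((z + τ z) / (w + τ w)) = (z + τ z) / (w + τ w) := by
    rw [map_div₀, div_eq_div_iff ((map_ne_zero τ).2 hw) hw]
    have hE : p ^ 2 * A * τ (w + τ w) ≠ 0 := mul_ne_zero hD ((map_ne_zero τ).2 hw)
    rw [← sw] at hE
    refine mul_left_cancel₀ (mul_ne_zero hD (right_ne_zero_of_mul hE)) ?_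
    linear_combination (z + τ z) * (τ p * B + p ^ 2 * A) * sw -
      (w + τ w) * (τ p * B + p ^ 2 * A) * sz
  rcases hfix _ hratio with h | h
  · have hz : z + τ z = 0 := (div_eq_zero_iff.1 h).resolve_right hw
    rcases hfix z (CharTwo.add_eq_zero.1 hz).symm with rfl | rfl
    · simp
    · simp
  · have hz : z + τ z = w + τ w := (div_eq_one_iff_eq hw).1 h
    rcases hfix (z + w) (by rw [map_add]; linear_combination -hz + (τ z - w) * two) with h' | h'
    · right; right; left
      rw [CharTwo.add_eq_zero.1 h']
    · right; right; right
      linear_combination p * h' - p * w * two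

end CharTwo

/-- The set `S` has even size, and the sums of `x`, `x ^ (2 ^ h + 1)` and `x ^ (2 ^ (h - 1) + 1)`
over `x ∈ S` vanish. -/
def PowerSumsVanish {K : Type*} [Field K] (h : ℕ) (S : Finset K) : Prop :=
  Even S.card ∧ ∑ x ∈ S, x = 0 ∧ ∑ x ∈ S, x ^ (2 ^ h + 1) = 0 ∧ ∑ x ∈ S, x ^ (2 ^ (h - 1) + 1) = 0

section CharTwo
variable {K : Type*} [Field K] [CharP K 2]

theorem add_pow_two_pow_add_one (k : ℕ) (x y : K) :
    (x + y) ^ (2 ^ k + 1) =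
      x ^ (2 ^ k + 1) + y ^ (2 ^ k + 1) + (x ^ 2 ^ k * y + x * y ^ 2 ^ k) := by
  rw [pow_succ, add_pow_char_pow]; ring

theorem PowerSumsVanish.translate {h : ℕ} {S : Finset K} (hS : PowerSumsVanish h S) (c : K) :
    PowerSumsVanish h (S.map (addRightEmbedding c)) := by
  obtain ⟨he, h1, h2, h3⟩ := hS
  have hcard : (S.card : K) = 0 := (CharP.cast_eq_zero_iff K 2 _).2 he.two_dvd
  have hfrob : ∀ k, ∑ x ∈ S, x ^ 2 ^ k = 0 := fun k => by
    rw [← sum_pow_char_pow, h1, zero_pow (by positivity)]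
  have key : ∀ k, ∑ x ∈ S, x ^ (2 ^ k + 1) = 0 → ∑ x ∈ S, (x + c) ^ (2 ^ k + 1) = 0 := by
    intro k hk
    simp only [add_pow_two_pow_add_one, Finset.sum_add_distrib, ← Finset.sum_mul, hk, h1, hfrob,
      Finset.sum_const, nsmul_eq_mul, hcard]
    ring
  refine ⟨by simpa using he, ?_, ?_, ?_⟩ <;> simp only [Finset.sum_map, addRightEmbedding_apply]
  · simp [Finset.sum_add_distrib, h1, hcard]
  · exact key _ h2
  · exact key _ h3

theorem PowerSumsVanish.card_ne_two {h : ℕ} {S : Finset K} (hS : PowerSumsVanish h S) :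
    S.card ≠ 2 := by
  intro hc
  classical
  obtain ⟨x, y, hxy, rfl⟩ := Finset.card_eq_two.1 hc
  have := hS.2.1
  rw [Finset.sum_pair hxy] at this
  exact hxy (CharTwo.add_eq_zero.1 this)

theorem PowerSumsVanish.card_ne_four {h : ℕ} (hh : 1 ≤ h) {S : Finset K}
    (hS : PowerSumsVanish h S) : S.card ≠ 4 := by
  intro hc
  classical
  obtain ⟨a, T, ha, rfl, hcard⟩ := Finset.card_eq_succ.1 hc
  obtain ⟨x, y, z, hxy, hxz, hyz, rfl⟩ := Finset.card_eq_three.1 hcard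
  obtain ⟨-, h1, h2, h3⟩ := hS
  have two : (2 : K) = 0 := CharTwo.two_eq_zero
  rw [Finset.sum_insert ha, Finset.sum_insert (by simp [hxy, hxz]), Finset.sum_pair hyz]
    at h1 h2 h3
  obtain rfl : a = x + y + z := by linear_combination h1 - (x + y + z) * two
  have key : ∀ k, (x + y + z) ^ (2 ^ k + 1) + (x ^ (2 ^ k + 1) +
      (y ^ (2 ^ k + 1) + z ^ (2 ^ k + 1))) = 0 → ((x + z) / (y + z)) ^ 2 ^ k = (x + z) / (y + z) := by
    intro k hk
    have hyz' : y + z ≠ 0 := fun h => hyz (CharTwo.add_eq_zero.1 h)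
    rw [div_pow, div_eq_div_iff (pow_ne_zero _ hyz') hyz']
    simp only [pow_succ, add_pow_char_pow] at hk ⊢
    linear_combination hk - (x ^ 2 ^ k * x + y ^ 2 ^ k * y + z ^ 2 ^ k * z + x * y ^ 2 ^ k +
      x * z ^ 2 ^ k + z * y ^ 2 ^ k) * two
  have k1 := key _ h2
  have k2 := key _ h3
  obtain ⟨h, rfl⟩ : ∃ l, h = l + 1 := ⟨h - 1, by omega⟩
  rw [Nat.add_sub_cancel] at k2
  rw [pow_succ, pow_mul, k2] at k1
  have hyz' : y + z ≠ 0 := fun h => hyz (CharTwo.add_eq_zero.1 h)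
  rcases eq_zero_or_eq_one_of_sq_eq_self k1 with h | h
  · exact hxz (CharTwo.add_eq_zero.1 ((div_eq_zero_iff.1 h).resolve_right hyz'))
  · exact hxy (add_right_cancel ((div_eq_one_iff_eq hyz').1 h))

theorem PowerSumsVanish.card_ne_six {h : ℕ} (hh : 1 ≤ h) (hK : ∀ x : K, x ^ 2 ^ (2 * h + 1) = x)
    {S : Finset K} (hS : PowerSumsVanish h S) : S.card ≠ 6 := by
  intro hc
  classical
  obtain ⟨a, T, ha, rfl, hcard⟩ := Finset.card_eq_succ.1 hc
  obtain ⟨b, U, hb, rfl, hcardU⟩ := Finset.card_eq_succ.1 hcard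
  obtain ⟨c, V, hc', rfl, hcardV⟩ := Finset.card_eq_succ.1 hcardU
  obtain ⟨x, y, z, hxy, hxz, hyz, rfl⟩ := Finset.card_eq_three.1 hcardV
  obtain ⟨-, h1, h2, h3⟩ := hS
  have two : (2 : K) = 0 := CharTwo.two_eq_zero
  rw [Finset.sum_insert ha, Finset.sum_insert hb, Finset.sum_insert hc',
    Finset.sum_insert (by simp [hxy, hxz]), Finset.sum_pair hyz] at h1 h2 h3
  simp only [Finset.mem_insert, Finset.mem_singleton, not_or] at ha hb hc'
  have hne : ∀ {u v : K}, u ≠ v → u + v ≠ 0 := fun h h' => h (CharTwo.add_eq_zero.1 h')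
  let τ : K →+* K := iterateFrobenius K 2 (h + 1)
  have hτd : ∀ u, τ u = u ^ 2 ^ (h + 1) := fun u => iterateFrobenius_def 2 (h + 1) u
  have hττ : ∀ u, τ (τ u) = u ^ 2 := fun u => by
    rw [hτd, hτd, ← pow_mul, ← pow_add, show h + 1 + (h + 1) = 2 * h + 1 + 1 by ring, pow_succ,
      pow_mul, hK]
  have e2 : ∀ u, τ (u ^ (2 ^ h + 1)) = u * τ u := fun u => by
    rw [pow_succ, map_mul, hτd (u ^ 2 ^ h), ← pow_mul, ← pow_add,
      show h + (h + 1) = 2 * h + 1 by ring, hK]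
  have e3 : ∀ u, τ (τ (τ (u ^ (2 ^ (h - 1) + 1)))) = u * τ u ^ 2 := fun u => by
    rw [hττ, ← map_pow, ← pow_mul, add_mul, ← pow_succ, Nat.sub_add_cancel hh, one_mul, pow_add,
      map_mul, hτd (u ^ 2 ^ h), ← pow_mul, ← pow_add, show h + (h + 1) = 2 * h + 1 by ring, hK,
      map_pow]
  have h2' := congrArg τ h2
  have h3' := congrArg (fun u => τ (τ (τ u))) h3
  simp only [map_add, e2, e3, map_zero] at h2' h3'
  obtain rfl : a = b + c + x + y + z := by linear_combination h1 - (b + c + x + y + z) * two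
  simp only [map_add] at h2' h3'
  have split : ∀ B C X Y Z : K, (b + c + x + y + z) * (B + C + X + Y + Z) +
      (b * B + (c * C + (x * X + (y * Y + z * Z)))) = 0 →
      (x + z) * (Y + Z) + (y + z) * (X + Z) =
        (b + c) * (B + X + Y + Z) + (b + x + y + z) * (B + C) := by
    intro B C X Y Z h
    linear_combination h - (b * B + c * C + x * X + y * Y + b * B + b * X + b * Y + b * Z + c * B +
      c * X + c * Y + c * Z + b * C + x * B + x * C + y * B + y * C + z * B + z * C) * two
  have r := mem_span_of_alternating_eq τ hττ (p := x + z) (q := y + z) (c := b + c)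
    (d := b + x + y + z) (hne hxz) (hne hyz) (fun h => hxy (add_right_cancel h))
    (by simpa only [map_add] using split _ _ _ _ _ h2')
    (by
      simp only [map_add, CharTwo.add_sq] at h3' ⊢
      exact split _ _ _ _ _ h3')
  obtain ⟨⟨hab, hac, hax, hay, haz⟩, ⟨hbc, -, -, -⟩, -⟩ := And.intro ha (And.intro hb hc')
  rcases r with r | r | r | r
  · exact hne hbc r
  · exact hay (by linear_combination r + (x + z) * two)
  · exact hax (by linear_combination r + (y + z) * two)
  · exact haz (by linear_combination r + (x + y + z) * two)

end CharTwo

section Existence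
variable {K : Type*} [Field K] [CharP K 2] 

theorem sum_symmDiff_of_charTwo [DecidableEq K] (S T : Finset K) (f : K → K) :
    ∑ x ∈ symmDiff S T, f x = ∑ x ∈ S, f x + ∑ x ∈ T, f x := by
  rw [Finset.symmDiff_def, Finset.sum_union (disjoint_sdiff_sdiff),
    ← Finset.sum_inter_add_sum_sdiff S T, ← Finset.sum_inter_add_sum_sdiff T S, Finset.inter_comm T S]
  linear_combination -(∑ x ∈ S ∩ T, f x) * (CharTwo.two_eq_zero : (2 : K) = 0)

theorem exists_powerSumsVanish_of_card_lt_choose [Fintype K] {h k : ℕ} (T : Finset (K × K × K))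
    (hT : ∀ S : Finset K,
      (∑ x ∈ S, x, ∑ x ∈ S, x ^ (2 ^ h + 1), ∑ x ∈ S, x ^ (2 ^ (h - 1) + 1)) ∈ T)
    (hcard : T.card < (Fintype.card K).choose k) :
    ∃ S : Finset K, S.Nonempty ∧ S.card ≤ 2 * k ∧ PowerSumsVanish h S := by
  classical
  rw [← Finset.card_univ, ← Finset.card_powersetCard] at hcard
  obtain ⟨A, hA, B, hB, hAB, heq⟩ :=
    Finset.exists_ne_map_eq_of_card_lt_of_maps_to hcard (fun S _ => hT S)
  simp only [Prod.mk.injEq] at heq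
  have hA' := (Finset.mem_powersetCard.1 hA).2
  have hB' := (Finset.mem_powersetCard.1 hB).2
  have hc : (symmDiff A B).card + 2 * (A ∩ B).card = 2 * k := by
    rw [Finset.symmDiff_def, Finset.card_union_of_disjoint disjoint_sdiff_sdiff]
    have e1 := Finset.card_inter_add_card_sdiff A B
    have e2 := Finset.card_inter_add_card_sdiff B A
    rw [Finset.inter_comm B A] at e2
    omega
  refine ⟨symmDiff A B, ?_, by omega, ?_, ?_, ?_, ?_⟩
  · rw [Finset.nonempty_iff_ne_empty]
    intro h
    exact hAB (symmDiff_eq_bot.1 h)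
  · rw [Nat.even_iff]; omega
  all_goals rw [sum_symmDiff_of_charTwo, CharTwo.add_eq_zero]
  exacts [heq.1, heq.2.1, heq.2.2]

theorem exists_powerSumsVanish_card_le_eight [Fintype K] (h : ℕ) (hK : 32 ≤ Fintype.card K) :
    ∃ S : Finset K, S.Nonempty ∧ S.card ≤ 8 ∧ PowerSumsVanish h S := by
  refine exists_powerSumsVanish_of_card_lt_choose (k := 4) Finset.univ (fun _ => Finset.mem_univ _) ?_
  rw [Finset.card_univ, Fintype.card_prod, Fintype.card_prod]
  have e := Nat.descFactorial_eq_factorial_mul_choose (Fintype.card K) 4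
  obtain ⟨w, hw⟩ := Nat.exists_eq_add_of_le' hK
  rw [hw] at e ⊢
  simp only [Nat.descFactorial, Nat.factorial, Nat.sub_zero] at e
  rw [show w + 32 - 3 = w + 29 by omega, show w + 32 - 2 = w + 30 by omega,
    show w + 32 - 1 = w + 31 by omega] at e
  nlinarith

theorem exists_powerSumsVanish_card_le_six [Fintype K] (h : ℕ) (hh : 3 ≤ h)
    (hK : Fintype.card K = 2 ^ (2 * h)) :
    ∃ S : Finset K, S.Nonempty ∧ S.card ≤ 6 ∧ PowerSumsVanish h S := by
  classical
  have hfix : (Finset.univ.filter fun x : K => x ^ 2 ^ h = x).card ≤ 2 ^ h := by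
    have hd := FiniteField.X_pow_card_sub_X_natDegree_eq K (Nat.one_lt_two_pow (by omega : h ≠ 0))
    have h0 := FiniteField.X_pow_card_sub_X_ne_zero K (Nat.one_lt_two_pow (by omega : h ≠ 0))
    calc _ ≤ (X ^ 2 ^ h - X : K[X]).roots.toFinset.card := by
          refine Finset.card_le_card fun x hx => ?_
          rw [Multiset.mem_toFinset, mem_roots h0]
          simpa [sub_eq_zero] using hx
      _ ≤ _ := (Multiset.toFinset_card_le _).trans ((card_roots' _).trans hd.le)
  refine exists_powerSumsVanish_of_card_lt_choose (k := 3)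
    (Finset.univ ×ˢ ((Finset.univ.filter fun x : K => x ^ 2 ^ h = x) ×ˢ Finset.univ))
    (fun S => ?_) ?_
  · simp only [Finset.mem_product, Finset.mem_univ, Finset.mem_filter, true_and, and_true]
    rw [sum_pow_char_pow]
    refine Finset.sum_congr rfl fun x _ => ?_
    have hx : x ^ 2 ^ (2 * h) = x := hK ▸ FiniteField.pow_card x
    rw [← pow_mul, add_mul, ← pow_add, ← two_mul, one_mul, pow_add, hx, pow_succ, mul_comm]
  · rw [Finset.card_product, Finset.card_product, Finset.card_univ]
    have e := Nat.descFactorial_eq_factorial_mul_choose (Fintype.card K) 3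
    rw [hK, mul_comm 2 h, pow_mul] at e ⊢
    have hr : 8 ≤ 2 ^ h := Nat.pow_le_pow_right (n := 2) (by norm_num) hh
    generalize 2 ^ h = r at *
    refine lt_of_le_of_lt (Nat.mul_le_mul_left _ (Nat.mul_le_mul_right _ hfix)) ?_
    obtain ⟨N, hN⟩ := Nat.exists_eq_add_of_le' (show 2 ≤ r ^ 2 by nlinarith)
    simp only [Nat.descFactorial, Nat.factorial, Nat.sub_zero] at e
    rw [hN, show N + 2 - 2 = N by omega, show N + 2 - 1 = N + 1 by omega] at e
    have hN8 : 8 * r ≤ N + 2 := by nlinarith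
    have hlt : 6 * (r * (N + 2)) < N * (N + 1) := by
      nlinarith [Nat.mul_le_mul_right (N + 1) hN8, Nat.mul_le_mul_right N hr,
        Nat.mul_le_mul_right r (show 62 ≤ N by omega)]
    have := Nat.mul_lt_mul_of_pos_left hlt (show 0 < N + 2 by omega)
    rw [hN]
    linarith

end Existence

section Codes
variable {F K : Type*} [Field F] [Field K] [Algebra F K]

theorem mem_cyclicCode_iff_dvd {n : ℕ} {g : F[X]} (hg : g ∣ X ^ n - 1) (c : Fin n → F) :
    c ∈ cyclicCode n g ↔ g ∣ ∑ i : Fin n, monomial (i : ℕ) (c i) := by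
  have hw : wordToQuotient F n c = Ideal.Quotient.mk (Ideal.span {(X ^ n - 1 : F[X])})
      (∑ i : Fin n, monomial (i : ℕ) (c i)) := by
    simp [wordToQuotient]
  rw [cyclicCode, Submodule.mem_comap, hw, Submodule.restrictScalars_mem,
    Ideal.mem_span_singleton]
  constructor
  · rintro ⟨y, hy⟩
    obtain ⟨y, rfl⟩ := Ideal.Quotient.mk_surjective y
    rw [← map_mul, Ideal.Quotient.eq, Ideal.mem_span_singleton] at hy
    exact (dvd_sub_left (dvd_mul_right g y)).1 (hg.trans hy)
  · exact map_dvd _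

theorem mem_bchCode_iff {n : ℕ} {α : K} (hα : α ^ n = 1) (δ : ℕ) (c : Fin n → F) :
    c ∈ bchCode F n α δ ↔
      ∀ j ∈ Finset.Icc 1 (δ - 1), ∑ i, algebraMap F K (c i) * (α ^ j) ^ (i : ℕ) = 0 := by
  have hdvd : ∀ p : F[X], bchGenerator F α δ ∣ p ↔
      ∀ j ∈ Finset.Icc 1 (δ - 1), aeval (α ^ j) p = 0 := by
    intro p
    simp only [← minpoly.dvd_iff]
    let _ : DecidableEq F := Classical.decEq F
    let _ : NormalizedGCDMonoid F[X] := UniqueFactorizationMonoid.toNormalizedGCDMonoid F[X]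
    exact Finset.lcm_dvd_iff
  rw [bchCode, mem_cyclicCode_iff_dvd, hdvd]
  · simp [aeval_monomial]
  · rw [hdvd]
    intro j _
    rw [map_sub, map_pow, aeval_X, map_one, ← pow_mul, mul_comm, pow_mul, hα, one_pow, sub_self]

theorem sum_pow_eq_zero_of_pow_eq_one {n : ℕ} {x : K} (hx : x ^ n = 1) (h1 : x ≠ 1) :
    ∑ i : Fin n, x ^ (i : ℕ) = 0 := by
  have := geom_sum_mul x n
  rw [hx, sub_self] at this
  rw [Fin.sum_univ_eq_sum_range (fun i => x ^ i)]
  exact (mul_eq_zero.1 this).resolve_right (sub_ne_zero.2 h1)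

/-- A word of the dual of a BCH code vanishes at `α ^ s` as soon as `-s q ^ k` is never congruent
to an exponent in the defining set. -/
theorem eval_eq_zero_of_mem_dualCode [Finite K] {n : ℕ} {α : K} (hα : α ^ n = 1) {δ s : ℕ}
    (hs : ∀ k < Module.finrank F K, ∀ j ∈ Finset.Icc 1 (δ - 1), α ^ (s * Nat.card F ^ k + j) ≠ 1)
    {v : Fin n → F} (hv : v ∈ dualCode (bchCode F n α δ)) :
    ∑ i, algebraMap F K (v i) * (α ^ s) ^ (i : ℕ) = 0 := by
  have := Finite.of_injective _ (FaithfulSMul.algebraMap_injective F K)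
  refine (traceForm_nondegenerate F K).1 _ fun β => ?_
  rw [Algebra.traceForm_apply, Finset.sum_mul, map_sum]
  have hmem : (fun i : Fin n => Algebra.trace F K ((α ^ s) ^ (i : ℕ) * β)) ∈ bchCode F n α δ := by
    rw [mem_bchCode_iff hα]
    intro j hj
    simp only [FiniteField.algebraMap_trace_eq_sum_pow, Finset.sum_mul]
    rw [Finset.sum_comm]
    refine Finset.sum_eq_zero fun k hk => ?_
    have := sum_pow_eq_zero_of_pow_eq_one (x := α ^ (s * Nat.card F ^ k + j))
      (by rw [← pow_mul, mul_comm, pow_mul, hα, one_pow]) (hs k (Finset.mem_range.1 hk) j hj)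
    rw [← mul_zero (β ^ Nat.card F ^ k), ← this, Finset.mul_sum]
    refine Finset.sum_congr rfl fun i _ => ?_
    rw [mul_pow]
    ring
  rw [← hv _ hmem]
  refine Finset.sum_congr rfl fun i _ => ?_
  rw [mul_assoc, ← Algebra.smul_def, map_smul, smul_eq_mul]

/-- Parseval's identity for the discrete Fourier transform of length `n`. -/
theorem sum_eval_mul_eval_eq {n : ℕ} {α : K} (hα : IsPrimitiveRoot α n) (v c : Fin n → K) :
    ∑ s : Fin n, (∑ i, v i * (α ^ (s : ℕ)) ^ (i : ℕ)) * ∑ i, c i * (α⁻¹ ^ (s : ℕ)) ^ (i : ℕ) =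
      n * ∑ i, v i * c i := by
  have hα0 : ∀ i : Fin n, α ≠ 0 := fun i => hα.ne_zero (by have := i.2; omega)
  simp only [Finset.sum_mul_sum]
  rw [Finset.sum_comm, Finset.mul_sum]
  refine Finset.sum_congr rfl fun i _ => ?_
  rw [Finset.sum_comm, Finset.sum_eq_single i]
  · have h0 := hα0 i
    have e : ∀ s : Fin n, v i * (α ^ (s : ℕ)) ^ (i : ℕ) * (c i * (α⁻¹ ^ (s : ℕ)) ^ (i : ℕ)) =
        v i * c i := fun s => by
      rw [mul_mul_mul_comm, ← mul_pow, ← mul_pow, mul_inv_cancel₀ h0, one_pow, one_pow, mul_one]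
    simp only [e, Finset.sum_const, Finset.card_univ, Fintype.card_fin, nsmul_eq_mul]
  · intro k _ hk
    have h0 := hα0 i
    have hx := sum_pow_eq_zero_of_pow_eq_one (x := α ^ (i : ℕ) * α⁻¹ ^ (k : ℕ)) (n := n) ?_ ?_
    · rw [← mul_zero (v i * c k), ← hx, Finset.mul_sum]
      refine Finset.sum_congr rfl fun s _ => ?_
      rw [mul_pow, ← pow_mul, ← pow_mul, ← pow_mul, ← pow_mul]
      ring
    · rw [mul_pow, pow_right_comm, pow_right_comm α⁻¹, inv_pow, hα.pow_eq_one]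
      simp
    · intro h
      rw [inv_pow, mul_inv_eq_one₀ (pow_ne_zero _ h0)] at h
      exact hk (Fin.ext (hα.pow_inj i.2 k.2 h)).symm
  · simp

end Codes

section Binary
variable {K : Type*} [Field K] [Algebra (ZMod 2) K]

open Classical in
/-- The set of `α ^ i` for `i` in the support of the word `v`. -/
noncomputable def locators {K : Type*} [Field K] {n : ℕ} (α : K) (v : Fin n → ZMod 2) : Finset K :=
  (Finset.univ.filter fun i => v i ≠ 0).image fun i : Fin n => α ^ (i : ℕ)

theorem card_locators {K : Type*} [Field K] {n : ℕ} {α : K} (hα : IsPrimitiveRoot α n) (v : Fin n → ZMod 2) :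
    (locators α v).card = hammingNorm v := by
  classical
  rw [locators, Finset.card_image_of_injective _ fun i j h => Fin.ext (hα.pow_inj i.2 j.2 h)]
  rfl

theorem sum_locators {n : ℕ} {α : K} (hα : IsPrimitiveRoot α n) (v : Fin n → ZMod 2) (s : ℕ) :
    ∑ x ∈ locators α v, x ^ s = ∑ i, algebraMap (ZMod 2) K (v i) * (α ^ s) ^ (i : ℕ) := by
  classical
  rw [locators, Finset.sum_image fun i _ j _ h => Fin.ext (hα.pow_inj i.2 j.2 h),
    Finset.sum_filter]
  refine Finset.sum_congr rfl fun i _ => ?_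
  rw [pow_right_comm]
  obtain h | h : v i = 0 ∨ v i = 1 := by
    generalize v i = a
    revert a
    decide
  all_goals simp [h]

theorem eval_two_mul {n : ℕ} (v : Fin n → ZMod 2) (x : K) (s : ℕ) :
    ∑ i, algebraMap (ZMod 2) K (v i) * (x ^ (2 * s)) ^ (i : ℕ) =
      (∑ i, algebraMap (ZMod 2) K (v i) * (x ^ s) ^ (i : ℕ)) ^ 2 := by
  have := charP_of_injective_algebraMap (algebraMap (ZMod 2) K).injective 2
  rw [sum_pow_char]
  refine Finset.sum_congr rfl fun i _ => ?_
  rw [mul_pow, ← map_pow, ZMod.pow_card, mul_comm 2 s, pow_mul, pow_right_comm]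

theorem powerSumsVanish_locators_iff {n : ℕ} {α : K} (hα : IsPrimitiveRoot α n)
    (v : Fin n → ZMod 2) (h : ℕ) :
    PowerSumsVanish h (locators α v) ↔ ∀ s ∈ ({0, 1, 2 ^ h + 1, 2 ^ (h - 1) + 1} : Set ℕ),
      ∑ i, algebraMap (ZMod 2) K (v i) * (α ^ s) ^ (i : ℕ) = 0 := by
  have := charP_of_injective_algebraMap (algebraMap (ZMod 2) K).injective 2
  simp only [Set.mem_insert_iff, Set.mem_singleton_iff, forall_eq_or_imp, forall_eq,
    ← sum_locators hα, pow_one]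
  rw [PowerSumsVanish]
  simp only [pow_zero, Finset.sum_const, nsmul_eq_mul, mul_one, CharP.cast_eq_zero_iff K 2,
    even_iff_two_dvd]

theorem two_pow_sub_one_sub_delta3 {m h : ℕ}
    (hm : m = 2 * h + 1 ∧ 2 ≤ h ∨ m = 2 * h ∧ 3 ≤ h) :
    delta3 2 m + (2 ^ (m - 1) + 2 ^ (m - h)) = 2 ^ m - 1 ∧ 0 < delta3 2 m := by
  have e1 : (m + 1) / 2 = m - h := by omega
  have e2 : 2 ^ m = 2 * 2 ^ (m - 1) := by rw [← pow_succ']; congr 1; omega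
  have e3 : 2 ^ (m - h + 1) ≤ 2 ^ (m - 1) := Nat.pow_le_pow_right (by norm_num) (by omega)
  have e4 : 2 ^ 2 ≤ 2 ^ (m - h) := Nat.pow_le_pow_right (by norm_num) (by omega)
  rw [pow_succ] at e3
  simp only [delta3, e1]
  omega

theorem powerSumsVanish_of_mem_dualCode {m h : ℕ}
    (hm : m = 2 * h + 1 ∧ 2 ≤ h ∨ m = 2 * h ∧ 3 ≤ h) (hK : Nat.card K = 2 ^ m) {α : K}
    (hα : IsPrimitiveRoot α (2 ^ m - 1)) {v : Fin (2 ^ m - 1) → ZMod 2}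
    (hv : v ∈ dualCode (bchCode (ZMod 2) (2 ^ m - 1) α (delta3 2 m))) :
    PowerSumsVanish h (locators α v) := by
  have : Finite K := Nat.finite_of_card_ne_zero (by rw [hK]; positivity)
  have hrank : Module.finrank (ZMod 2) K = m := by
    have := Module.natCard_eq_pow_finrank (K := ZMod 2) (V := K)
    rw [hK, Nat.card_zmod] at this
    exact (Nat.pow_right_injective le_rfl this).symm
  obtain ⟨hδ, hδ0⟩ := two_pow_sub_one_sub_delta3 hm
  rw [powerSumsVanish_locators_iff hα]
  intro s hs
  refine eval_eq_zero_of_mem_dualCode hα.pow_eq_one (fun k hk j hj h1 => ?_) hv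
  rw [hrank] at hk
  rw [Nat.card_zmod] at h1
  rw [Finset.mem_Icc] at hj
  have small : ∀ t, t ≤ 2 ^ (m - 1) + 2 ^ (m - h) → α ^ (s * 2 ^ k) = α ^ t → False := by
    intro t ht hst
    rw [pow_add, hst, ← pow_add] at h1
    exact hα.pow_ne_one_of_pos_of_lt (by omega) (by omega) h1
  have hwrap : ∀ x y, α ^ (2 ^ m * x + y) = α ^ (x + y) := by
    intro x y
    rw [pow_add, pow_mul, show 2 ^ m = 2 ^ m - 1 + 1 from (Nat.sub_add_cancel Nat.one_le_two_pow).symm,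
      pow_succ, hα.pow_eq_one, one_mul, pow_add]
  have hk1 : 2 ^ k ≤ 2 ^ (m - 1) := Nat.pow_le_pow_right (by norm_num) (by omega)
  have two_bits : ∀ a, a = h ∨ a = h - 1 → s = 2 ^ a + 1 → False := by
    intro a ha hs
    rcases Nat.lt_or_ge (k + a) m with hlt | hge
    · refine small (2 ^ (k + a) + 2 ^ k) (add_le_add ?_ ?_) ?_
      · exact Nat.pow_le_pow_right (by norm_num) (by omega)
      · exact Nat.pow_le_pow_right (by norm_num) (by omega)
      · rw [hs, add_mul, one_mul, ← pow_add, add_comm a]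
    · refine small (2 ^ (k + a - m) + 2 ^ k) (by
        rw [add_comm]
        exact add_le_add hk1 (Nat.pow_le_pow_right (by norm_num) (by omega))) ?_
      rw [hs, ← hwrap, ← pow_add, Nat.add_sub_cancel' hge, add_mul, one_mul, ← pow_add, add_comm a]
  rcases hs with rfl | rfl | hs | hs
  · exact small 0 (Nat.zero_le _) (by rw [zero_mul])
  · exact small (2 ^ k) (le_add_right hk1) (by rw [one_mul])
  · exact two_bits _ (Or.inl rfl) hs
  · exact two_bits _ (Or.inr rfl) hs

theorem mem_dualCode_of_powerSumsVanish {m h : ℕ}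
    (hm : m = 2 * h + 1 ∧ 2 ≤ h ∨ m = 2 * h ∧ 3 ≤ h) {α : K}
    (hα : IsPrimitiveRoot α (2 ^ m - 1)) {v : Fin (2 ^ m - 1) → ZMod 2}
    (hv : PowerSumsVanish h (locators α v)) :
    v ∈ dualCode (bchCode (ZMod 2) (2 ^ m - 1) α (delta3 2 m)) := by
  have := charP_of_injective_algebraMap (algebraMap (ZMod 2) K).injective 2
  obtain ⟨hδ, hδ0⟩ := two_pow_sub_one_sub_delta3 hm
  rw [powerSumsVanish_locators_iff hα] at hv
  intro c hc
  rw [mem_bchCode_iff hα.pow_eq_one] at hc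
  have hzero : ∀ s < 2 ^ m - 1,
      (∑ i, algebraMap (ZMod 2) K (v i) * (α ^ s) ^ (i : ℕ)) = 0 ∨
        ∑ i, algebraMap (ZMod 2) K (c i) * (α⁻¹ ^ s) ^ (i : ℕ) = 0 := by
    refine forall_lt_of_rotation_invariant hm _ (fun s hs => ?_) (fun s hs => ?_)
      (fun s h1 h2 => Or.inr ?_) ?_ ?_ ?_ ?_
    · simpa only [eval_two_mul, pow_eq_zero_iff two_ne_zero] using hs
    · simpa only [pow_add, inv_pow α (2 ^ m - 1), hα.pow_eq_one, inv_one, mul_one] using hs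
    · have e : α⁻¹ ^ s = α ^ (2 ^ m - 1 - s) := by
        rw [inv_pow]
        refine inv_eq_of_mul_eq_one_right ?_
        rw [← pow_add, Nat.add_sub_cancel' h2.le, hα.pow_eq_one]
      rw [e]
      exact hc _ (Finset.mem_Icc.2 (by omega))
    all_goals exact Or.inl (hv _ (by simp))
  apply (algebraMap (ZMod 2) K).injective
  have hn : ((2 ^ m - 1 : ℕ) : K) = 1 := by
    rw [Nat.cast_sub Nat.one_le_two_pow, Nat.cast_pow, Nat.cast_ofNat, CharTwo.two_eq_zero,
      zero_pow (by omega), Nat.cast_one, zero_sub, CharTwo.neg_eq]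
  rw [map_sum, map_zero, ← one_mul (∑ i, _), ← hn]
  simp only [map_mul]
  rw [← sum_eval_mul_eval_eq hα]
  exact Finset.sum_eq_zero fun s _ => mul_eq_zero.2 (hzero s s.2)

theorem exists_locators_eq {K : Type*} [Field K] {n : ℕ} (α : K) (S : Finset K)
    (hS : ∀ x ∈ S, ∃ i < n, α ^ i = x) : ∃ v : Fin n → ZMod 2, locators α v = S := by
  classical
  refine ⟨fun i => if α ^ (i : ℕ) ∈ S then 1 else 0, ?_⟩
  ext x
  simp only [locators, Finset.mem_image, Finset.mem_filter, Finset.mem_univ, true_and, ne_eq,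
    ite_eq_right_iff, one_ne_zero, imp_false, not_not]
  constructor
  · rintro ⟨i, hi, rfl⟩; exact hi
  · intro hx
    obtain ⟨i, hi, rfl⟩ := hS x hx
    exact ⟨⟨i, hi⟩, hx, rfl⟩

theorem hasMinimumDistance_dualCode {m h d : ℕ}
    (hm : m = 2 * h + 1 ∧ 2 ≤ h ∨ m = 2 * h ∧ 3 ≤ h) (hK : Nat.card K = 2 ^ m) {α : Kˣ}
    (hα : ∀ x : Kˣ, x ∈ Subgroup.zpowers α) (hd : d < 2 ^ m)
    (hlower : ∀ S : Finset K, S.Nonempty → PowerSumsVanish h S → d ≤ S.card)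
    (hupper : ∃ S : Finset K, S.Nonempty ∧ S.card ≤ d ∧ PowerSumsVanish h S) :
    HasMinimumDistance (dualCode (bchCode (ZMod 2) (2 ^ m - 1) (α : K) (delta3 2 m))) d := by
  have := charP_of_injective_algebraMap (algebraMap (ZMod 2) K).injective 2
  have : Finite K := Nat.finite_of_card_ne_zero (by rw [hK]; positivity)
  have := Fintype.ofFinite K
  have hord : orderOf α = 2 ^ m - 1 := by
    rw [orderOf_eq_card_of_forall_mem_zpowers hα, Nat.card_units, hK]
  have hprim : IsPrimitiveRoot (α : K) (2 ^ m - 1) := by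
    rw [IsPrimitiveRoot.coe_units_iff, ← hord]
    exact IsPrimitiveRoot.orderOf α
  constructor
  · obtain ⟨S, hS, hSd, hSv⟩ := hupper
    obtain ⟨c, hc⟩ : ∃ c, c ∉ S := by
      by_contra! hall
      rw [Finset.eq_univ_iff_forall.2 hall, Finset.card_univ, ← Nat.card_eq_fintype_card, hK] at hSd
      omega
    have hTv := hSv.translate c
    obtain ⟨v, hv⟩ := exists_locators_eq (α : K) (S.map (addRightEmbedding c)) (fun x hx => by
      obtain ⟨y, hy, rfl⟩ := Finset.mem_map.1 hx
      have hne : y + c ≠ 0 := fun h0 => hc (CharTwo.add_eq_zero.1 h0 ▸ hy)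
      obtain ⟨i, hix⟩ := (Submonoid.mem_powers_iff _ _).1
        (mem_powers_iff_mem_zpowers.2 (hα (Units.mk0 _ hne)))
      refine ⟨i % (2 ^ m - 1), Nat.mod_lt _ (by rw [← hord]; exact orderOf_pos α), ?_⟩
      rw [← hord, ← Units.val_pow_eq_pow_val, pow_mod_orderOf, hix, Units.val_mk0,
        addRightEmbedding_apply])
    have hcard := card_locators hprim v
    rw [← hv] at hTv
    have hle := hlower _ hS hSv
    rw [hv, Finset.card_map] at hcard
    refine ⟨v, mem_dualCode_of_powerSumsVanish hm hprim hTv, 0, Submodule.zero_mem _, ?_, ?_⟩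
    · intro hv0
      rw [hv0, hammingNorm_zero, Finset.card_eq_zero] at hcard
      exact hS.ne_empty hcard
    · rw [hammingDist_zero_right]; omega
  · rintro k ⟨u, hu, v, hv, huv, rfl⟩
    rw [hammingDist_comm, hammingDist_eq_hammingNorm, ← sub_eq_neg_add, ← card_locators hprim]
    refine hlower _ ?_ (powerSumsVanish_of_mem_dualCode hm hK hprim (Submodule.sub_mem _ hu hv))
    rw [← Finset.card_pos, card_locators hprim, hammingNorm_pos_iff]
    exact sub_ne_zero.2 huv

end Binary

theorem mainTheorem9 {K : Type*} [Field K] [Algebra (ZMod 2) K] (m : ℕ)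
    (hK : Nat.card K = 2 ^ m) (α : Kˣ) (hα : ∀ x : Kˣ, x ∈ Subgroup.zpowers α) :
    (5 ≤ m → Odd m →
      HasMinimumDistance (dualCode (bchCode (ZMod 2) (2 ^ m - 1) (α : K) (delta3 2 m))) 8) ∧
    (6 ≤ m → Even m →
      HasMinimumDistance (dualCode (bchCode (ZMod 2) (2 ^ m - 1) (α : K) (delta3 2 m))) 6) := by
  have := charP_of_injective_algebraMap (algebraMap (ZMod 2) K).injective 2
  have : Finite K := Nat.finite_of_card_ne_zero (by rw [hK]; positivity)
  have := Fintype.ofFinite K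
  have hcard : Fintype.card K = 2 ^ m := by rw [← Nat.card_eq_fintype_card, hK]
  have h32 : 5 ≤ m → 2 ^ 5 ≤ 2 ^ m := fun hm => Nat.pow_le_pow_right (by norm_num) hm
  constructor
  · rintro hm ⟨h, rfl⟩
    refine hasMinimumDistance_dualCode (h := h) (by omega) hK hα (by have := h32 hm; omega) ?_
      (exists_powerSumsVanish_card_le_eight h (by have := h32 hm; omega))
    intro S hS hv
    have h1 := Finset.card_pos.2 hS
    have h2 := hv.card_ne_two
    have h4 := hv.card_ne_four (by omega)
    have h6 := hv.card_ne_six (by omega) (fun x => hcard ▸ FiniteField.pow_card x)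
    obtain ⟨k, hk⟩ := hv.1
    omega
  · rintro hm ⟨h, rfl⟩
    rw [← two_mul] at *
    refine hasMinimumDistance_dualCode (h := h) (by omega) hK hα
      (by have := h32 (by omega); omega) ?_ (exists_powerSumsVanish_card_le_six h (by omega) hcard)
    intro S hS hv
    have h1 := Finset.card_pos.2 hS
    have h2 := hv.card_ne_two
    have h4 := hv.card_ne_four (by omega)
    obtain ⟨k, hk⟩ := hv.1
    omega
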